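/- Let $p_0,p_1,p_2\in\mathbb R[s]$ with $p_1/p_2$ not a constant ($p_2\neq0$), and put $p(s,k)=p_0(s)+k_1p_1(s)+k_2p_2(s)$ for $k=(k_1,k_2)\in\mathbb R^2$. Assume that $p(\cdot,k)$ is monic for every $k$. A real polynomial is called stable if all its complex roots lie in the open left half-plane; let $\mathcal S=\{k\in\mathbb R^2: p(\cdot,k)\text{ is stable}\}$ and $\mathcal C=\{k\in\mathbb R^2: p(j\omega,k)=0\text{ for some }\omega\in\mathbb R\}$, where $j^2=-1$. For a real polynomial $q$ let $q_R,q_I$ be the real polynomials with $q(j\omega)=q_R(\omega^2)+j\omega\,q_I(\omega^2)$. For real polynomials $a,b$ of degree at most $n$, the Bézoutian of size $n$ is the symmetric matrix $B(a,b)=(b_{ij})_{i,j=1}^n$ with $\frac{a(u)b(v)-a(v)b(u)}{v-u}=\sum_{i,j=1}^n b_{ij}u^{i-1}v^{j-1}$. The Hermite matrix $H(k)$ is the Bézoutian, of size $\deg p(\cdot,k)$, of $p_R(\omega^2,k)$ and $\omega p_I(\omega^2,k)$ as polynomials in $\omega$. Put $$q_0=p_{1I}p_{2R}-p_{1R}p_{2I},\quad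 q_1=p_{2I}p_{0R}-p_{2R}p_{0I},\quad q_2=-p_{1I}p_{0R}+p_{1R}p_{0I},$$ $$G(k)=B(q_1,q_2)+k_1B(q_2,q_0)-k_2B(q_1,q_0)=B(q_1-k_1q_0,\;q_2-k_2q_0),$$ with Bézoutians of size $\max(\deg q_0,\deg q_1,\deg q_2)$, $l(k)=p_R(0,k)=p_{0R}(0)+k_1p_{1R}(0)+k_2p_{2R}(0)$, and $C(k)=\mathrm{diag}\{l(k),G(k)\}$, a symmetric pencil affine in $k$. Let $\mathcal S_i$ be a connected component of $\mathbb R^2\setminus\mathcal C$, and suppose that $H(k)\succ0$ and $C(k)\succ0$ at some point $k$ in the interior of $\mathcal S_i$. Then $\mathcal S_i$ is an LMI region, i.e. $\mathcal S_i=\{k: F_0+k_1F_1+k_2F_2\succ0\}$ for some real symmetric matrices $F_0,F_1,F_2$ of equal size; precisely, $\mathcal S_i=\{k:C(k)\succ0\}$ and its closure is $\{k:C(k)\succeq0\}$. Moreover $\mathcal S_i\subseteq\mathcal S$. -/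

import Mathlib

namespace TwoParam

open Polynomial

/-- The polynomial `p(s,k) = p₀(s) + k₁ p₁(s) + k₂ p₂(s)`. -/
noncomputable def paramPoly (p₀ p₁ p₂ : ℝ[X]) (k : ℝ × ℝ) : ℝ[X] :=
  p₀ + C k.1 * p₁ + C k.2 * p₂

/-- Continuous-time stability: all complex roots lie in the open left half-plane. -/
def IsStable (p : ℝ[X]) : Prop :=
  ∀ z : ℂ, aeval z p = 0 → z.re < 0

/-- The stability region in the parameter plane. -/
def stabilityRegion (p₀ p₁ p₂ : ℝ[X]) : Set (ℝ × ℝ) :=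
  {k | IsStable (paramPoly p₀ p₁ p₂ k)}

/-- The curve of parameters for which the polynomial has a root on the imaginary axis. -/
def curve (p₀ p₁ p₂ : ℝ[X]) : Set (ℝ × ℝ) :=
  {k | ∃ ω : ℝ, aeval (Complex.I * (ω : ℂ)) (paramPoly p₀ p₁ p₂ k) = 0}

/-- The polynomial `p_R` with `p_R(ω²) = Re p(jω)`, see `aeval_I_mul`. -/
noncomputable def rePart (p : ℝ[X]) : ℝ[X] :=
  ∑ i ∈ Finset.range (p.natDegree + 1), monomial i ((-1) ^ i * p.coeff (2 * i))

/-- The polynomial `p_I` with `ω p_I(ω²) = Im p(jω)`, see `aeval_I_mul`. -/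
noncomputable def imPart (p : ℝ[X]) : ℝ[X] :=
  ∑ i ∈ Finset.range (p.natDegree + 1), monomial i ((-1) ^ i * p.coeff (2 * i + 1))

/-- `p(jω) = p_R(ω²) + j ω p_I(ω²)`. -/
theorem aeval_I_mul (p : ℝ[X]) (ω : ℝ) :
    aeval (Complex.I * (ω : ℂ)) p =
      (((rePart p).eval (ω ^ 2) : ℝ) : ℂ) +
        Complex.I * ((ω * (imPart p).eval (ω ^ 2) : ℝ) : ℂ) := by
  have hsplit : ∀ (f : ℕ → ℂ) (N : ℕ), ∑ i ∈ Finset.range (2 * N), f i =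
      ∑ i ∈ Finset.range N, (f (2 * i) + f (2 * i + 1)) := by
    intro f N
    induction N with
    | zero => simp
    | succ N ih =>
      rw [show 2 * (N + 1) = 2 * N + 1 + 1 by ring, Finset.sum_range_succ,
        Finset.sum_range_succ, ih, Finset.sum_range_succ]
      ring
  rw [aeval_eq_sum_range' (n := 2 * (p.natDegree + 1)) (by omega), hsplit]
  simp only [rePart, imPart, eval_finsetSum, eval_monomial, Finset.mul_sum]
  push_cast
  rw [Finset.mul_sum, ← Finset.sum_add_distrib]
  refine Finset.sum_congr rfl fun i _ => ?_
  simp only [Complex.real_smul, pow_add, pow_mul, mul_pow, Complex.I_sq, pow_one]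
  ring

/-- The Bézoutian matrix of size `n` of two polynomials of degree at most `n`: the symmetric matrix
with `(a(u) b(v) - a(v) b(u)) / (v - u) = ∑ i j, b i j * u ^ i * v ^ j` (indices from `0`), in
closed form; the defining equation is `bezoutian_spec`. -/
noncomputable def bezoutian (n : ℕ) (a b : ℝ[X]) : Matrix (Fin n) (Fin n) ℝ :=
  Matrix.of fun i j => ∑ t ∈ Finset.range (min (i : ℕ) (j : ℕ) + 1),
    (a.coeff t * b.coeff (i + j + 1 - t) - a.coeff (i + j + 1 - t) * b.coeff t)

/-- The defining equation of the Bézoutian, in every commutative real algebra (for instance the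
bivariate polynomials, or `ℂ`). -/
theorem bezoutian_spec {A : Type*} [CommRing A] [Algebra ℝ A] (n : ℕ) (a b : ℝ[X])
    (ha : a.natDegree ≤ n) (hb : b.natDegree ≤ n) (u v : A) :
    aeval u a * aeval v b - aeval v a * aeval u b =
      (v - u) * ∑ i, ∑ j, algebraMap ℝ A (bezoutian n a b i j) * u ^ (i : ℕ) * v ^ (j : ℕ) := by
  set s : ℕ → ℕ → ℕ → ℝ := fun N i j => ∑ t ∈ Finset.range N,
    (a.coeff t * b.coeff (i + j - t) - a.coeff (i + j - t) * b.coeff t) with hs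
  have hB : ∑ i : Fin n, ∑ j : Fin n,
      algebraMap ℝ A (bezoutian n a b i j) * u ^ (i : ℕ) * v ^ (j : ℕ) =
      ∑ i ∈ Finset.range n, ∑ j ∈ Finset.range n,
        algebraMap ℝ A (s (min i j + 1) i (j + 1)) * u ^ i * v ^ j := by
    rw [Finset.sum_range]
    refine Finset.sum_congr rfl fun i _ => ?_
    rw [Finset.sum_range]
    rfl
  have hzero : ∀ N i j, (∀ t < N, n < i + j - t) → s N i j = 0 := by
    intro N i j h
    refine Finset.sum_eq_zero fun t ht => ?_
    have h1 := h t (Finset.mem_range.1 ht)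
    rw [coeff_eq_zero_of_natDegree_lt (p := a) (n := i + j - t) (by omega),
      coeff_eq_zero_of_natDegree_lt (p := b) (n := i + j - t) (by omega)]
    ring
  have hV : v * ∑ i ∈ Finset.range n, ∑ j ∈ Finset.range n,
        algebraMap ℝ A (s (min i j + 1) i (j + 1)) * u ^ i * v ^ j =
      ∑ i ∈ Finset.range (n + 1), ∑ j ∈ Finset.range (n + 1),
        algebraMap ℝ A (s (min (i + 1) j) i j) * u ^ i * v ^ j := by
    rw [Finset.sum_range_succ, Finset.mul_sum]
    rw [Finset.sum_eq_zero (s := Finset.range (n + 1)), add_zero]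
    · refine Finset.sum_congr rfl fun i _ => ?_
      rw [Finset.sum_range_succ', Finset.mul_sum]
      simp only [hs, Nat.min_zero, Finset.range_zero, Finset.sum_empty, map_zero, zero_mul,
        add_zero]
      refine Finset.sum_congr rfl fun j _ => ?_
      rw [show min (i + 1) (j + 1) = min i j + 1 by omega]
      ring
    · intro j _
      rw [hzero _ _ _ (fun t ht => by omega)]
      simp
  have hU : u * ∑ i ∈ Finset.range n, ∑ j ∈ Finset.range n,
        algebraMap ℝ A (s (min i j + 1) i (j + 1)) * u ^ i * v ^ j =
      ∑ i ∈ Finset.range (n + 1), ∑ j ∈ Finset.range (n + 1),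
        algebraMap ℝ A (s (min i (j + 1)) i j) * u ^ i * v ^ j := by
    rw [Finset.sum_range_succ', Finset.mul_sum]
    rw [Finset.sum_eq_zero (s := Finset.range (n + 1)), add_zero]
    · refine Finset.sum_congr rfl fun i _ => ?_
      rw [Finset.sum_range_succ, Finset.mul_sum, hzero _ _ _ (fun t ht => by omega)]
      simp only [map_zero, zero_mul, add_zero]
      refine Finset.sum_congr rfl fun j _ => ?_
      rw [show min (i + 1) (j + 1) = min i j + 1 by omega]
      simp only [hs, show i + (j + 1) = i + 1 + j by omega]
      ring
    · intro j _
      simp [hs]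
  have hdiff : ∀ i j, s (min (i + 1) j) i j - s (min i (j + 1)) i j =
      a.coeff i * b.coeff j - a.coeff j * b.coeff i := by
    intro i j
    rcases lt_trichotomy i j with h | h | h
    · rw [show min (i + 1) j = i + 1 by omega, show min i (j + 1) = i by omega]
      simp only [hs, Finset.sum_range_succ, show i + j - i = j by omega]
      ring
    · subst h
      rw [show min (i + 1) i = i by omega, show min i (i + 1) = i by omega]
      ring
    · rw [show min (i + 1) j = j by omega, show min i (j + 1) = j + 1 by omega]
      simp only [hs, Finset.sum_range_succ, show i + j - j = i by omega]
      ring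
  rw [hB, sub_mul, hV, hU, aeval_eq_sum_range' (p := a) (n := n + 1) (by omega),
    aeval_eq_sum_range' (p := b) (n := n + 1) (by omega),
    aeval_eq_sum_range' (p := a) (n := n + 1) (by omega),
    aeval_eq_sum_range' (p := b) (n := n + 1) (by omega),
    Finset.sum_mul_sum, mul_comm (∑ i ∈ Finset.range (n + 1), a.coeff i • v ^ i),
    Finset.sum_mul_sum, ← Finset.sum_sub_distrib, ← Finset.sum_sub_distrib]
  refine Finset.sum_congr rfl fun i _ => ?_
  rw [← Finset.sum_sub_distrib, ← Finset.sum_sub_distrib]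
  refine Finset.sum_congr rfl fun j _ => ?_
  have h := congrArg (algebraMap ℝ A) (hdiff i j)
  simp only [map_sub, map_mul] at h
  simp only [Algebra.smul_def]
  linear_combination (-(u ^ i * v ^ j)) * h

/-- The Hermite matrix of `p`: the Bézoutian of `Re p(jω)` and `Im p(jω)` as polynomials in `ω`. -/
noncomputable def hermiteMatrix (p : ℝ[X]) : Matrix (Fin p.natDegree) (Fin p.natDegree) ℝ :=
  bezoutian p.natDegree ((rePart p).comp (X ^ 2)) (X * (imPart p).comp (X ^ 2))

/-- The common denominator of the rational parametrization `k₁ = q₁ / q₀`, `k₂ = q₂ / q₀`. -/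
noncomputable def q₀ (p₁ p₂ : ℝ[X]) : ℝ[X] :=
  imPart p₁ * rePart p₂ - rePart p₁ * imPart p₂

/-- The numerator of `k₁ = q₁ / q₀`. -/
noncomputable def q₁ (p₀ p₂ : ℝ[X]) : ℝ[X] :=
  imPart p₂ * rePart p₀ - rePart p₂ * imPart p₀

/-- The numerator of `k₂ = q₂ / q₀`. -/
noncomputable def q₂ (p₀ p₁ : ℝ[X]) : ℝ[X] :=
  -imPart p₁ * rePart p₀ + rePart p₁ * imPart p₀

/-- The size of the pencil `G`: the largest degree of `q₀`, `q₁`, `q₂`. -/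
noncomputable def pencilSize (p₀ p₁ p₂ : ℝ[X]) : ℕ :=
  max (q₀ p₁ p₂).natDegree (max (q₁ p₀ p₂).natDegree (q₂ p₀ p₁).natDegree)

/-- The symmetric affine pencil
`G(k) = B(q₁,q₂) + k₁ B(q₂,q₀) + k₂ B(q₀,q₁) = B(q₁ - k₁ q₀, q₂ - k₂ q₀)`. -/
noncomputable def pencilG (p₀ p₁ p₂ : ℝ[X]) (k : ℝ × ℝ) :
    Matrix (Fin (pencilSize p₀ p₁ p₂)) (Fin (pencilSize p₀ p₁ p₂)) ℝ :=
  bezoutian (pencilSize p₀ p₁ p₂) (q₁ p₀ p₂) (q₂ p₀ p₁) +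
    k.1 • bezoutian (pencilSize p₀ p₁ p₂) (q₂ p₀ p₁) (q₀ p₁ p₂) +
    k.2 • bezoutian (pencilSize p₀ p₁ p₂) (q₀ p₁ p₂) (q₁ p₀ p₂)

/-- The affine form `l(k) = p_R(0,k)`. -/
noncomputable def lineForm (p₀ p₁ p₂ : ℝ[X]) (k : ℝ × ℝ) : ℝ :=
  (rePart p₀).eval 0 + k.1 * (rePart p₁).eval 0 + k.2 * (rePart p₂).eval 0

/-- The affine pencil `C(k) = diag {l(k), G(k)}`. -/
noncomputable def pencilC (p₀ p₁ p₂ : ℝ[X]) (k : ℝ × ℝ) :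
    Matrix (Fin 1 ⊕ Fin (pencilSize p₀ p₁ p₂)) (Fin 1 ⊕ Fin (pencilSize p₀ p₁ p₂)) ℝ :=
  Matrix.fromBlocks (Matrix.of fun _ _ => lineForm p₀ p₁ p₂ k) 0 0 (pencilG p₀ p₁ p₂ k)

/-- A planar set is an LMI region if it is `{k : F₀ + k₁ F₁ + k₂ F₂ ≻ 0}` for some real symmetric
matrices of the same size. -/
def IsLMIRegion (Ω : Set (ℝ × ℝ)) : Prop :=
  ∃ (m : ℕ) (F₀ F₁ F₂ : Matrix (Fin m) (Fin m) ℝ),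
    F₀.IsSymm ∧ F₁.IsSymm ∧ F₂.IsSymm ∧ Ω = {k | (F₀ + k.1 • F₁ + k.2 • F₂).PosDef}

end TwoParam

namespace TwoParam

open Polynomial Matrix Topology

/-! The equations p_R(λ,k) = p_I(λ,k) = 0 are linear in k, and Cramer's rule gives k = (q₁/q₀,
q₂/q₀)(λ). The Bézoutian G(k) of q₁ - k₁q₀ and q₂ - k₂q₀ implicitizes this rational curve: it is
singular exactly when the two polynomials share a complex root (`det_bezoutian_ne_zero_iff`). Its
size is the right one for every k, because the top coefficients do not depend on k and do not both
vanish (`coeff_shifted_ne_zero`).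

A point of the curve comes from ω = 0, where l(k) = 0, or from a common root ω² of p_R and p_I,
where G(k) is singular. So Ω = {C ≻ 0} avoids the curve. It is convex, hence connected. The
hypothesis H ≻ 0 excludes roots in the open right half-plane, so the given point, being off the
curve, is stable; stability is open, and it is closed off the curve, so it spreads over Ω.

It remains that Ω is closed in the complement of the curve. At a limit point C ⪰ 0, and if C is
singular then either l = 0, which lies on the curve, or G is singular. In the latter case a common
root λ with q₀(λ) = 0 would be shared for every k, against G ≻ 0 at the given point; otherwise λ is
a common root of p_R and p_I, so p has roots s and -s. Limits of stable polynomials have no root in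
the open right half-plane, so s is imaginary and the point is on the curve. Thus Ω is open,
connected and relatively closed: it is the component. These facts are collected in
`pencil_region_properties`. -/

/-! ### Even and odd parts of a real polynomial -/

theorem coeff_rePart (p : ℝ[X]) (i : ℕ) :
    (rePart p).coeff i = (-1) ^ i * p.coeff (2 * i) := by
  simp only [rePart, finsetSum_coeff, coeff_monomial, Finset.sum_ite_eq', Finset.mem_range]
  split_ifs with h
  · rfl
  · rw [coeff_eq_zero_of_natDegree_lt (by omega), mul_zero]

theorem coeff_imPart (p : ℝ[X]) (i : ℕ) :
    (imPart p).coeff i = (-1) ^ i * p.coeff (2 * i + 1) := by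
  simp only [imPart, finsetSum_coeff, coeff_monomial, Finset.sum_ite_eq', Finset.mem_range]
  split_ifs with h
  · rfl
  · rw [coeff_eq_zero_of_natDegree_lt (by omega), mul_zero]

theorem rePart_paramPoly (p₀ p₁ p₂ : ℝ[X]) (k : ℝ × ℝ) :
    rePart (paramPoly p₀ p₁ p₂ k) = rePart p₀ + C k.1 * rePart p₁ + C k.2 * rePart p₂ := by
  ext i
  simp only [coeff_rePart, paramPoly, coeff_add, coeff_C_mul]
  ring

theorem imPart_paramPoly (p₀ p₁ p₂ : ℝ[X]) (k : ℝ × ℝ) :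
    imPart (paramPoly p₀ p₁ p₂ k) = imPart p₀ + C k.1 * imPart p₁ + C k.2 * imPart p₂ := by
  ext i
  simp only [coeff_imPart, paramPoly, coeff_add, coeff_C_mul]
  ring

/-- Extends `aeval_I_mul` from the imaginary axis to a polynomial identity, so that p_R and p_I can
be evaluated at complex points. -/
theorem eq_rePart_comp_add (p : ℝ[X]) :
    p = (rePart p).comp (-X ^ 2) + X * (imPart p).comp (-X ^ 2) := by
  induction p using Polynomial.induction_on' with
  | add p q hp hq =>
    have h1 : rePart (p + q) = rePart p + rePart q := by
      ext i; simp only [coeff_rePart, coeff_add]; ring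
    have h2 : imPart (p + q) = imPart p + imPart q := by
      ext i; simp only [coeff_imPart, coeff_add]; ring
    rw [h1, h2, add_comp, add_comp]
    linear_combination hp + hq
  | monomial n a =>
    obtain ⟨m, rfl | rfl⟩ := n.even_or_odd'
    · have h1 : rePart (monomial (2 * m) a) = monomial m ((-1) ^ m * a) := by
        ext i
        simp only [coeff_rePart, coeff_monomial]
        by_cases h : m = i
        · simp [h]
        · simp [h]
      have h2 : imPart (monomial (2 * m) a) = 0 := by
        ext i
        simp only [coeff_imPart, coeff_monomial, coeff_zero]
        rw [if_neg (by omega), mul_zero]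
      rw [h1, h2]
      simp only [← C_mul_X_pow_eq_monomial, mul_comp, C_comp, pow_comp, X_comp, zero_comp]
      rw [neg_pow (X ^ 2 : ℝ[X]) m, C_mul, C_pow, C_neg, C_1, ← pow_mul]
      have : ((-1 : ℝ[X]) ^ m) * (-1) ^ m = 1 := by rw [← mul_pow]; simp
      linear_combination (-C a * X ^ (2 * m)) * this
    · have h1 : imPart (monomial (2 * m + 1) a) = monomial m ((-1) ^ m * a) := by
        ext i
        simp only [coeff_imPart, coeff_monomial]
        by_cases h : m = i
        · simp [h]
        · simp [h]
      have h2 : rePart (monomial (2 * m + 1) a) = 0 := by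
        ext i
        simp only [coeff_rePart, coeff_monomial, coeff_zero]
        rw [if_neg (by omega), mul_zero]
      rw [h1, h2]
      simp only [← C_mul_X_pow_eq_monomial, mul_comp, C_comp, pow_comp, X_comp, zero_comp]
      rw [neg_pow (X ^ 2 : ℝ[X]) m, C_mul, C_pow, C_neg, C_1, ← pow_mul]
      have : ((-1 : ℝ[X]) ^ m) * (-1) ^ m = 1 := by rw [← mul_pow]; simp
      linear_combination (-C a * X ^ (2 * m + 1)) * this

/-- `p(z) = p_R(-z²) + z p_I(-z²)` in every commutative real algebra. -/
theorem aeval_eq_rePart_add {A : Type*} [CommRing A] [Algebra ℝ A] (p : ℝ[X]) (z : A) :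
    aeval z p = aeval (-z ^ 2) (rePart p) + z * aeval (-z ^ 2) (imPart p) := by
  conv_lhs => rw [eq_rePart_comp_add p]
  simp [aeval_comp]

/-- The parity of the degree of `p` decides which part receives the leading coefficient; that part
dominates the same part of every polynomial of lower degree. -/
theorem degree_rePart_imPart_lt {p : ℝ[X]} (hp : p ≠ 0) :
    (∀ q : ℝ[X], q.degree < p.degree → (rePart q).degree < (rePart p).degree) ∨
      ∀ q : ℝ[X], q.degree < p.degree → (imPart q).degree < (imPart p).degree := by
  have hlc : p.coeff p.natDegree ≠ 0 := leadingCoeff_ne_zero.2 hp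
  have hq : ∀ q : ℝ[X], q.degree < p.degree → ∀ i, p.natDegree ≤ i → q.coeff i = 0 := by
    intro q hq i hi
    refine coeff_eq_zero_of_degree_lt (hq.trans_le ?_)
    rw [degree_eq_natDegree hp]
    exact_mod_cast hi
  obtain ⟨m, hm | hm⟩ := p.natDegree.even_or_odd'
  · left
    intro q h
    refine lt_of_lt_of_le ((degree_lt_iff_coeff_zero _ m).2 fun i hi => ?_)
      (le_degree_of_ne_zero (n := m) ?_)
    · rw [coeff_rePart, hq q h _ (by omega), mul_zero]
    · rw [coeff_rePart, ← hm]
      exact mul_ne_zero (by simp) hlc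
  · right
    intro q h
    refine lt_of_lt_of_le ((degree_lt_iff_coeff_zero _ m).2 fun i hi => ?_)
      (le_degree_of_ne_zero (n := m) ?_)
    · rw [coeff_imPart, hq q h _ (by omega), mul_zero]
    · rw [coeff_imPart, ← hm]
      exact mul_ne_zero (by simp) hlc

theorem isCoprime_of_forall_aeval {a b : ℝ[X]}
    (h : ∀ z : ℂ, aeval z a = 0 → aeval z b ≠ 0) : IsCoprime a b := by
  rw [Polynomial.isCoprime_iff_aeval_ne_zero_of_isAlgClosed ℝ ℂ]
  intro z
  by_cases hz : aeval z a = 0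
  · exact Or.inr (h z hz)
  · exact Or.inl hz

theorem aeval_ne_zero_of_isCoprime {a b : ℝ[X]} (h : IsCoprime a b) (z : ℂ)
    (ha : aeval z a = 0) : aeval z b ≠ 0 :=
  ((Polynomial.isCoprime_iff_aeval_ne_zero_of_isAlgClosed ℝ ℂ a b).1 h z).resolve_left (· ha)

/-- A common root of `p_R` and `p_I` yields a pair of opposite roots of `p`. -/
theorem exists_opposite_roots {p : ℝ[X]} {l : ℂ} (hR : aeval l (rePart p) = 0)
    (hI : aeval l (imPart p) = 0) :
    ∃ s : ℂ, l = -s ^ 2 ∧ aeval s p = 0 ∧ aeval (-s) p = 0 := by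
  obtain ⟨s, hs⟩ := IsAlgClosed.exists_pow_nat_eq (-l) two_pos
  have hl : l = -s ^ 2 := by rw [hs, neg_neg]
  refine ⟨s, hl, ?_, ?_⟩
  · rw [aeval_eq_rePart_add, ← hl, hR, hI]; simp
  · rw [aeval_eq_rePart_add, neg_sq, ← hl, hR, hI]; simp

/-- Opposite roots s and -s cannot both have negative real part. -/
theorem IsStable.isCoprime_rePart_imPart {p : ℝ[X]} (hp : IsStable p) :
    IsCoprime (rePart p) (imPart p) := by
  refine isCoprime_of_forall_aeval fun z hR hI => ?_
  obtain ⟨s, -, h1, h2⟩ := exists_opposite_roots hR hI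
  have h1 := hp _ h1
  have h2 := hp _ h2
  rw [Complex.neg_re] at h2
  linarith

/-! ### Bézoutians and coprimality -/

theorem bezoutian_isSymm (n : ℕ) (a b : ℝ[X]) : (bezoutian n a b).IsSymm := by
  ext i j
  simp only [Matrix.transpose_apply, bezoutian, Matrix.of_apply, min_comm (j : ℕ), add_comm (j : ℕ)]

theorem bezoutian_swap (n : ℕ) (a b : ℝ[X]) : bezoutian n b a = -bezoutian n a b := by
  ext i j
  simp only [bezoutian, Matrix.of_apply, Matrix.neg_apply, ← Finset.sum_neg_distrib]
  exact Finset.sum_congr rfl fun _ _ => by ring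

/-- A kernel vector x is read as a functional φ on ℝ[X]/(a) with φ(X^j) = x_j. The kernel condition
forces φ to vanish on the ideal (b) as well, and (a, b) is the whole ring, so x = 0. -/
theorem det_bezoutian_ne_zero_of_coeff_left {n : ℕ} {a b : ℝ[X]} (ha : a.natDegree ≤ n)
    (hb : b.natDegree ≤ n) (hn : a.coeff n ≠ 0) (hab : IsCoprime a b) :
    (bezoutian n a b).det ≠ 0 := by
  intro hdet
  obtain ⟨x, hx0, hx⟩ := Matrix.exists_mulVec_eq_zero_iff.2 hdet
  have han : a.natDegree = n := le_antisymm ha (le_natDegree_of_ne_zero hn)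
  have ha0 : a ≠ 0 := by rintro rfl; simp at hn
  set a' := a * C a.leadingCoeff⁻¹ with ha'
  have hmon : a'.Monic := monic_mul_leadingCoeff_inv ha0
  have hdeg : a'.degree = n := by
    rw [ha', degree_mul_leadingCoeff_inv a ha0, degree_eq_natDegree ha0, han]
  obtain ⟨φ, hφa, hφx⟩ : ∃ φ : ℝ[X] →ₗ[ℝ] ℝ, (∀ f, φ (a * f) = 0) ∧
      ∀ j : Fin n, φ (X ^ (j : ℕ)) = x j := by
    refine ⟨∑ j : Fin n, x j • (lcoeff ℝ (j : ℕ) ∘ₗ modByMonicHom a'), fun f => ?_, fun j => ?_⟩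
    · have : (a * f) %ₘ a' = 0 := by
        rw [modByMonic_eq_zero_iff_dvd hmon]
        refine (Dvd.intro (C a.leadingCoeff) ?_).mul_right f
        rw [ha', mul_assoc, ← C_mul, inv_mul_cancel₀ (leadingCoeff_ne_zero.2 ha0), C_1, mul_one]
      simp [modByMonicHom, this]
    · have : (X ^ (j : ℕ) : ℝ[X]) %ₘ a' = X ^ (j : ℕ) := by
        rw [modByMonic_eq_self_iff hmon, hdeg, degree_X_pow]
        exact_mod_cast j.2
      simp [modByMonicHom, this, coeff_X_pow, Fin.val_inj]
  set S : ℝ → ℝ[X] := fun t => ∑ i : Fin n, ∑ j : Fin n,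
    C (bezoutian n a b i j) * C t ^ (i : ℕ) * X ^ (j : ℕ) with hS
  have hspec : ∀ t, C (a.eval t) * b - a * C (b.eval t) = (X - C t) * S t := by
    intro t
    have h := bezoutian_spec n a b ha hb (C t) (X : ℝ[X])
    have hC : ∀ p : ℝ[X], aeval (C t) p = C (p.eval t) := fun p => by
      rw [← algebraMap_eq, aeval_algebraMap_apply, coe_aeval_eq_eval]
    rw [hC, hC, aeval_X_left_apply, aeval_X_left_apply] at h
    exact h
  have hφC : ∀ (c : ℝ) (f : ℝ[X]), φ (C c * f) = c * φ f := fun c f => by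
    rw [← smul_eq_C_mul, map_smul, smul_eq_mul]
  have hφS : ∀ (m : ℕ) (t : ℝ), φ (X ^ m * S t) = ∑ i : Fin n,
      (∑ j : Fin n, bezoutian n a b i j * φ (X ^ (m + (j : ℕ)))) * t ^ (i : ℕ) := by
    intro m t
    simp only [hS, Finset.mul_sum, map_sum, Finset.sum_mul]
    refine Finset.sum_congr rfl fun i _ => Finset.sum_congr rfl fun j _ => ?_
    rw [show (X : ℝ[X]) ^ m * (C (bezoutian n a b i j) * C t ^ (i : ℕ) * X ^ (j : ℕ)) =
      C (bezoutian n a b i j * t ^ (i : ℕ)) * X ^ (m + (j : ℕ)) by rw [C_mul, C_pow, pow_add]; ring, hφC]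
    ring
  have hstep : ∀ m : ℕ, (∀ t, φ (X ^ m * S t) = 0) →
      φ (X ^ m * b) = 0 ∧ ∀ t, φ (X ^ (m + 1) * S t) = 0 := by
    intro m hm
    -- Apply φ to X^m times `hspec`: the multiples of `a` die, and so does the term with X^m S_t.
    have key : ∀ t, φ (X ^ (m + 1) * S t) = a.eval t * φ (X ^ m * b) := by
      intro t
      have h := congrArg (fun f => φ (X ^ m * f)) (hspec t)
      rw [show X ^ m * (C (a.eval t) * b - a * C (b.eval t)) =
        C (a.eval t) * (X ^ m * b) - a * (X ^ m * C (b.eval t)) by ring,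
        show X ^ m * ((X - C t) * S t) = X ^ (m + 1) * S t - C t * (X ^ m * S t) by ring,
        map_sub, map_sub, hφa, hφC, hφC, hm] at h
      linarith
    -- As a polynomial in t the left side of `key` has degree below n, while `a` has degree exactly
    -- n; so the scalar φ(X^m b) vanishes.
    have hpoly : ∑ i : Fin n, C (∑ j : Fin n, bezoutian n a b i j * φ (X ^ (m + 1 + (j : ℕ)))) *
        X ^ (i : ℕ) = a * C (φ (X ^ m * b)) := by
      refine Polynomial.funext fun t => ?_
      rw [eval_mul, eval_C, ← key, hφS]
      simp only [eval_finsetSum, eval_mul, eval_C, eval_pow, eval_X]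
    have hc : φ (X ^ m * b) = 0 := by
      have h := congrArg (fun f => f.coeff n) hpoly
      simp only [finsetSum_coeff, coeff_C_mul_X_pow, coeff_mul_C] at h
      rw [Finset.sum_eq_zero fun i _ => if_neg (Nat.ne_of_gt i.2)] at h
      exact (mul_eq_zero.1 h.symm).resolve_left hn
    exact ⟨hc, fun t => by rw [key, hc, mul_zero]⟩
  have hall : ∀ (m : ℕ) (t : ℝ), φ (X ^ m * S t) = 0 := by
    intro m
    induction m with
    | zero =>
      intro t
      rw [hφS]
      refine Finset.sum_eq_zero fun i _ => ?_
      have h := congrFun hx i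
      simp only [Matrix.mulVec, dotProduct, Pi.zero_apply] at h
      simp only [zero_add, hφx, h, zero_mul]
    | succ m ih => exact (hstep m ih).2
  have hφb : ∀ f, φ (f * b) = 0 := by
    intro f
    induction f using Polynomial.induction_on' with
    | add p q hp hq => rw [add_mul, map_add, hp, hq, add_zero]
    | monomial m c => rw [← C_mul_X_pow_eq_monomial, mul_assoc, hφC, (hstep m (hall m)).1, mul_zero]
  obtain ⟨r, s, hrs⟩ := hab
  refine hx0 (funext fun j => ?_)
  rw [Pi.zero_apply, ← hφx j, ← mul_one (X ^ (j : ℕ)), ← hrs,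
    show X ^ (j : ℕ) * (r * a + s * b) = a * (X ^ (j : ℕ) * r) + (X ^ (j : ℕ) * s) * b by ring,
    map_add, hφa, hφb, add_zero]

/-- With v a common root l, the defining equation becomes 0 = (l - u) times a polynomial in u, whose
coefficients are the entries of B applied to (l^j). For n = 0 that vector is empty and the
determinant is 1. -/
theorem det_bezoutian_eq_zero_of_root {n : ℕ} (hn : n ≠ 0) {a b : ℝ[X]} (ha : a.natDegree ≤ n)
    (hb : b.natDegree ≤ n) {l : ℂ} (hal : aeval l a = 0) (hbl : aeval l b = 0) :
    (bezoutian n a b).det = 0 := by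
  have h := bezoutian_spec n a b ha hb (X : ℂ[X]) (C l)
  have hC : ∀ p : ℝ[X], aeval (C l) p = C (aeval l p) := fun p => by
    rw [← algebraMap_eq, aeval_algebraMap_apply]
  rw [hC, hC, hal, hbl, C_0, mul_zero, zero_mul, sub_zero, eq_comm, mul_eq_zero] at h
  replace h := h.resolve_left (sub_ne_zero.2 (X_ne_C l).symm)
  have hker : (bezoutian n a b).map (algebraMap ℝ ℂ) *ᵥ (fun j : Fin n => l ^ (j : ℕ)) = 0 := by
    funext i
    have hi := congrArg (fun f : ℂ[X] => f.coeff (i : ℕ)) h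
    simp only [finsetSum_coeff, coeff_zero] at hi
    rw [Pi.zero_apply, ← hi, Finset.sum_eq_single_of_mem i (Finset.mem_univ i)]
    · simp only [mulVec, dotProduct]
      refine Finset.sum_congr rfl fun j _ => ?_
      rw [← C_pow, coeff_mul_C, IsScalarTower.algebraMap_apply ℝ ℂ ℂ[X], algebraMap_eq,
        coeff_C_mul_X_pow, if_pos rfl]
      rfl
    · intro i' _ hne
      refine Finset.sum_eq_zero fun j _ => ?_
      rw [← C_pow, coeff_mul_C, IsScalarTower.algebraMap_apply ℝ ℂ ℂ[X], algebraMap_eq,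
        coeff_C_mul_X_pow, if_neg (fun h => hne (Fin.ext h.symm)), zero_mul]
  have hdet : ((bezoutian n a b).map (algebraMap ℝ ℂ)).det = 0 := by
    refine Matrix.exists_mulVec_eq_zero_iff.1 ⟨_, fun h0 => ?_, hker⟩
    have := congrFun h0 ⟨0, Nat.pos_of_ne_zero hn⟩
    simp at this
  rw [← RingHom.mapMatrix_apply, ← RingHom.map_det] at hdet
  simpa using hdet

/-- If the degrees of `a` and `b` are at most `n`, with equality for one of them, the Bézoutian of
size `n` is invertible iff `a` and `b` are coprime. -/
theorem det_bezoutian_ne_zero_iff {n : ℕ} {a b : ℝ[X]} (ha : a.natDegree ≤ n)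
    (hb : b.natDegree ≤ n) (hn : a.coeff n ≠ 0 ∨ b.coeff n ≠ 0) :
    (bezoutian n a b).det ≠ 0 ↔ IsCoprime a b := by
  constructor
  · intro hdet
    refine isCoprime_of_forall_aeval fun l hal hbl => hdet ?_
    refine det_bezoutian_eq_zero_of_root ?_ ha hb hal hbl
    rintro rfl
    rw [eq_C_of_natDegree_le_zero ha, aeval_C] at hal
    rw [eq_C_of_natDegree_le_zero hb, aeval_C] at hbl
    simp only [Complex.coe_algebraMap, Complex.ofReal_eq_zero] at hal hbl
    exact hn.elim (· hal) (· hbl)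
  · intro hab
    rcases hn with hn | hn
    · exact det_bezoutian_ne_zero_of_coeff_left ha hb hn hab
    · rw [bezoutian_swap, Matrix.det_neg]
      exact mul_ne_zero (by simp) (det_bezoutian_ne_zero_of_coeff_left hb ha hn hab.symm)

/-! ### The Hermite matrix and roots in the right half-plane -/

theorem two_mul_natDegree_rePart_le (p : ℝ[X]) : 2 * (rePart p).natDegree ≤ p.natDegree := by
  by_cases h : rePart p = 0
  · simp [h]
  · refine le_natDegree_of_ne_zero fun h0 => leadingCoeff_ne_zero.2 h ?_
    rw [leadingCoeff, coeff_rePart, h0, mul_zero]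

theorem two_mul_natDegree_imPart_add_one_le {p : ℝ[X]} (h : imPart p ≠ 0) :
    2 * (imPart p).natDegree + 1 ≤ p.natDegree := by
  refine le_natDegree_of_ne_zero fun h0 => leadingCoeff_ne_zero.2 h ?_
  rw [leadingCoeff, coeff_imPart, h0, mul_zero]

theorem re_sum_pos_of_posDef {n : ℕ} {M : Matrix (Fin n) (Fin n) ℝ} (hM : M.PosDef) (hn : n ≠ 0)
    (u : ℂ) : 0 < (∑ i, ∑ j, algebraMap ℝ ℂ (M i j) * u ^ (i : ℕ) *
      (starRingEnd ℂ u) ^ (j : ℕ)).re := by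
  have hre : (∑ i, ∑ j, algebraMap ℝ ℂ (M i j) * u ^ (i : ℕ) *
      (starRingEnd ℂ u) ^ (j : ℕ)).re =
      (fun i : Fin n => (u ^ (i : ℕ)).re) ⬝ᵥ M *ᵥ (fun i : Fin n => (u ^ (i : ℕ)).re) +
      (fun i : Fin n => (u ^ (i : ℕ)).im) ⬝ᵥ M *ᵥ (fun i : Fin n => (u ^ (i : ℕ)).im) := by
    simp only [dotProduct, Matrix.mulVec, Complex.re_sum, Finset.mul_sum, ← Finset.sum_add_distrib]
    refine Finset.sum_congr rfl fun i _ => Finset.sum_congr rfl fun j _ => ?_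
    rw [← map_pow, Complex.coe_algebraMap, mul_assoc, Complex.re_ofReal_mul, Complex.mul_re,
      Complex.conj_re, Complex.conj_im]
    ring
  rw [hre]
  refine add_pos_of_pos_of_nonneg ?_ ?_
  · refine hM.dotProduct_mulVec_pos (x := fun i : Fin n => (u ^ (i : ℕ)).re) fun h0 => ?_
    have := congrFun h0 ⟨0, Nat.pos_of_ne_zero hn⟩
    simp at this
  · exact hM.posSemidef.dotProduct_mulVec_nonneg (fun i : Fin n => (u ^ (i : ℕ)).im)

/-- If the Hermite matrix is positive definite, no root lies in the open right half-plane. -/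
theorem re_le_zero_of_hermiteMatrix_posDef {p : ℝ[X]} (hp : p.natDegree ≠ 0)
    (hH : (hermiteMatrix p).PosDef) {z : ℂ} (hz : aeval z p = 0) : z.re ≤ 0 := by
  by_contra! hre
  set a := (rePart p).comp (X ^ 2) with ha
  set b := X * (imPart p).comp (X ^ 2) with hb
  have hda : a.natDegree ≤ p.natDegree := by
    rw [ha, natDegree_comp, natDegree_X_pow, mul_comm]
    exact two_mul_natDegree_rePart_le p
  have hdb : b.natDegree ≤ p.natDegree := by
    by_cases h : imPart p = 0
    · simp [hb, h]
    · refine natDegree_mul_le.trans ?_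
      rw [natDegree_X, natDegree_comp, natDegree_X_pow]
      have := two_mul_natDegree_imPart_add_one_le h
      omega
  -- Here z = iu, so p(z) = a(u) + i b(u). Since p(z) = 0, the defining equation at (u, ū) reads
  -- -|b(u)|² = Re z · S with Re S > 0.
  set u : ℂ := -Complex.I * z with hu
  have hspec := bezoutian_spec p.natDegree a b hda hdb u (starRingEnd ℂ u)
  have hpos := re_sum_pos_of_posDef hH hp u
  have hconj : ∀ q : ℝ[X], aeval (starRingEnd ℂ u) q = starRingEnd ℂ (aeval u q) := fun q => by
    rw [aeval_conj]
  have hroot : aeval u a + Complex.I * aeval u b = 0 := by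
    rw [aeval_eq_rePart_add] at hz
    rw [ha, hb, map_mul, aeval_comp, aeval_comp, map_pow, aeval_X, hu, ← hz,
      show (-Complex.I * z) ^ 2 = -z ^ 2 by rw [mul_pow, neg_sq, Complex.I_sq]; ring]
    linear_combination (-z * aeval (-z ^ 2) (imPart p)) * Complex.I_sq
  change _ = _ * ∑ i, ∑ j, algebraMap ℝ ℂ (hermiteMatrix p i j) * _ * _ at hspec
  set S := ∑ i, ∑ j, algebraMap ℝ ℂ (hermiteMatrix p i j) * u ^ (i : ℕ) *
    (starRingEnd ℂ u) ^ (j : ℕ) with hS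
  rw [hconj, hconj] at hspec
  have ha' : aeval u a = -Complex.I * aeval u b := by linear_combination hroot
  have hvu : starRingEnd ℂ u - u = 2 * Complex.I * (z.re : ℂ) := by
    apply Complex.ext <;> simp [hu]
    ring
  rw [ha', hvu, map_mul (starRingEnd ℂ) _ (aeval u b), map_neg, Complex.conj_I] at hspec
  have h2 : -(Complex.normSq (aeval u b) : ℂ) = z.re * S := by
    rw [← Complex.mul_conj]
    have hI : (2 * Complex.I : ℂ) ≠ 0 := by simp
    apply mul_left_cancel₀ hI
    linear_combination hspec
  have h3 := congrArg Complex.re h2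
  rw [Complex.re_ofReal_mul, Complex.neg_re, Complex.ofReal_re] at h3
  have := Complex.normSq_nonneg (aeval u b)
  have := mul_pos hre hpos
  linarith

/-! ### Degrees in the monic family -/

theorem degree_lt_of_forall_monic {p q : ℝ[X]} (h : ∀ t : ℝ, (p + C t * q).Monic) :
    q.degree < p.degree := by
  by_contra! hle
  have hp : p.Monic := by simpa using h 0
  have hq : q ≠ 0 := by
    rintro rfl
    rw [degree_zero, le_bot_iff, degree_eq_bot] at hle
    exact hp.ne_zero hle
  have hlc : q.leadingCoeff ≠ 0 := leadingCoeff_ne_zero.2 hq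
  set m := q.natDegree with hm
  -- This t makes the leading coefficient of p + tq equal to 2.
  set t := (2 - p.coeff m) / q.leadingCoeff with ht
  have hcoeff : (p + C t * q).coeff m = 2 := by
    rw [coeff_add, coeff_C_mul, hm, coeff_natDegree, ht, div_mul_cancel₀ _ hlc, ← hm]
    ring
  have hdeg : (p + C t * q).natDegree = m := by
    refine le_antisymm ?_ (le_natDegree_of_ne_zero (by rw [hcoeff]; norm_num))
    exact (natDegree_add_le _ _).trans
      (max_le (natDegree_le_natDegree hle) (natDegree_C_mul_le _ _))
  have h1 := (h t).coeff_natDegree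
  rw [hdeg, hcoeff] at h1
  norm_num at h1

theorem degree_fst_lt {p₀ p₁ p₂ : ℝ[X]} (hmonic : ∀ k, (paramPoly p₀ p₁ p₂ k).Monic) :
    p₁.degree < p₀.degree :=
  degree_lt_of_forall_monic fun t => by simpa [paramPoly] using hmonic (t, 0)

theorem degree_snd_lt {p₀ p₁ p₂ : ℝ[X]} (hmonic : ∀ k, (paramPoly p₀ p₁ p₂ k).Monic) :
    p₂.degree < p₀.degree :=
  degree_lt_of_forall_monic fun t => by simpa [paramPoly] using hmonic (0, t)

theorem degree_paramPoly {p₀ p₁ p₂ : ℝ[X]} (h₁ : p₁.degree < p₀.degree)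
    (h₂ : p₂.degree < p₀.degree) (k : ℝ × ℝ) : (paramPoly p₀ p₁ p₂ k).degree = p₀.degree := by
  have hC : ∀ (c : ℝ) (q : ℝ[X]), q.degree < p₀.degree → (C c * q).degree < p₀.degree :=
    fun c q hq => by rw [← smul_eq_C_mul]; exact (degree_smul_le _ _).trans_lt hq
  have h := degree_add_eq_left_of_degree_lt (hC k.1 _ h₁)
  rw [paramPoly, degree_add_eq_left_of_degree_lt (by rw [h]; exact hC k.2 _ h₂), h]

/-! ### The polynomials q₁ - k₁q₀ and q₂ - k₂q₀ -/

/-- The polynomial `q₁ - k₁ q₀`. -/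
noncomputable def shiftedFst (p₀ p₁ p₂ : ℝ[X]) (k : ℝ × ℝ) : ℝ[X] :=
  q₁ p₀ p₂ - C k.1 * q₀ p₁ p₂

/-- The polynomial `q₂ - k₂ q₀`. -/
noncomputable def shiftedSnd (p₀ p₁ p₂ : ℝ[X]) (k : ℝ × ℝ) : ℝ[X] :=
  q₂ p₀ p₁ - C k.2 * q₀ p₁ p₂

theorem shiftedFst_eq (p₀ p₁ p₂ : ℝ[X]) (k : ℝ × ℝ) :
    shiftedFst p₀ p₁ p₂ k = imPart p₂ * rePart (paramPoly p₀ p₁ p₂ k) -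
      rePart p₂ * imPart (paramPoly p₀ p₁ p₂ k) := by
  rw [rePart_paramPoly, imPart_paramPoly, shiftedFst, q₁, q₀]
  ring

theorem shiftedSnd_eq (p₀ p₁ p₂ : ℝ[X]) (k : ℝ × ℝ) :
    shiftedSnd p₀ p₁ p₂ k = -imPart p₁ * rePart (paramPoly p₀ p₁ p₂ k) +
      rePart p₁ * imPart (paramPoly p₀ p₁ p₂ k) := by
  rw [rePart_paramPoly, imPart_paramPoly, shiftedSnd, q₂, q₀]
  ring

theorem q₀_mul_rePart (p₀ p₁ p₂ : ℝ[X]) (k : ℝ × ℝ) :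
    q₀ p₁ p₂ * rePart (paramPoly p₀ p₁ p₂ k) =
      -(shiftedFst p₀ p₁ p₂ k * rePart p₁ + shiftedSnd p₀ p₁ p₂ k * rePart p₂) := by
  rw [shiftedFst_eq, shiftedSnd_eq, q₀]
  ring

theorem q₀_mul_imPart (p₀ p₁ p₂ : ℝ[X]) (k : ℝ × ℝ) :
    q₀ p₁ p₂ * imPart (paramPoly p₀ p₁ p₂ k) =
      -(shiftedFst p₀ p₁ p₂ k * imPart p₁ + shiftedSnd p₀ p₁ p₂ k * imPart p₂) := by
  rw [shiftedFst_eq, shiftedSnd_eq, q₀]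
  ring

theorem natDegree_q₀_le (p₀ p₁ p₂ : ℝ[X]) : (q₀ p₁ p₂).natDegree ≤ pencilSize p₀ p₁ p₂ :=
  le_max_left _ _

theorem natDegree_q₁_le (p₀ p₁ p₂ : ℝ[X]) : (q₁ p₀ p₂).natDegree ≤ pencilSize p₀ p₁ p₂ :=
  (le_max_left _ _).trans (le_max_right _ _)

theorem natDegree_q₂_le (p₀ p₁ p₂ : ℝ[X]) : (q₂ p₀ p₁).natDegree ≤ pencilSize p₀ p₁ p₂ :=
  (le_max_right _ _).trans (le_max_right _ _)

theorem natDegree_shiftedFst_le (p₀ p₁ p₂ : ℝ[X]) (k : ℝ × ℝ) :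
    (shiftedFst p₀ p₁ p₂ k).natDegree ≤ pencilSize p₀ p₁ p₂ :=
  (natDegree_sub_le _ _).trans (max_le (natDegree_q₁_le _ _ _)
    ((natDegree_C_mul_le _ _).trans (natDegree_q₀_le _ _ _)))

theorem natDegree_shiftedSnd_le (p₀ p₁ p₂ : ℝ[X]) (k : ℝ × ℝ) :
    (shiftedSnd p₀ p₁ p₂ k).natDegree ≤ pencilSize p₀ p₁ p₂ :=
  (natDegree_sub_le _ _).trans (max_le (natDegree_q₂_le _ _ _)
    ((natDegree_C_mul_le _ _).trans (natDegree_q₀_le _ _ _)))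

theorem pencilG_eq_bezoutian (p₀ p₁ p₂ : ℝ[X]) (k : ℝ × ℝ) :
    pencilG p₀ p₁ p₂ k =
      bezoutian (pencilSize p₀ p₁ p₂) (shiftedFst p₀ p₁ p₂ k) (shiftedSnd p₀ p₁ p₂ k) := by
  ext i j
  simp only [pencilG, bezoutian, shiftedFst, shiftedSnd, Matrix.add_apply, Matrix.smul_apply,
    Matrix.of_apply, smul_eq_mul, Finset.mul_sum, ← Finset.sum_add_distrib, coeff_sub, coeff_C_mul]
  exact Finset.sum_congr rfl fun _ _ => by ring

/-- At k = 0, `q₀_mul_rePart` and `q₀_mul_imPart` express q₀ times a part of p₀ through the same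
parts of p₁ and p₂. For the part that dominates, a q₀ of full degree would make the left side too
large. Hence the top coefficients of the shifted polynomials do not depend on k. -/
theorem coeff_q₀_eq_zero {p₀ p₁ p₂ : ℝ[X]} (h₁ : p₁.degree < p₀.degree)
    (h₂ : p₂.degree < p₀.degree) : (q₀ p₁ p₂).coeff (pencilSize p₀ p₁ p₂) = 0 := by
  by_contra hc
  set n := pencilSize p₀ p₁ p₂ with hn
  have hq : (q₀ p₁ p₂).degree = n := le_antisymm
    (degree_le_of_natDegree_le (natDegree_q₀_le _ _ _)) (le_degree_of_ne_zero hc)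
  have key : ∀ a a₁ a₂ : ℝ[X], a₁.degree < a.degree → a₂.degree < a.degree →
      q₀ p₁ p₂ * a ≠ -(shiftedFst p₀ p₁ p₂ 0 * a₁ + shiftedSnd p₀ p₁ p₂ 0 * a₂) := by
    intro a a₁ a₂ ha₁ ha₂ h
    have hmul : ∀ b c : ℝ[X], b.natDegree ≤ n → c.degree < a.degree →
        (b * c).degree < n + a.degree := by
      intro b c hb hc
      rw [degree_mul]
      exact (add_le_add_left (degree_le_of_natDegree_le hb) _).trans_lt
        (WithBot.add_lt_add_left (by simp) hc)
    have hlt : (q₀ p₁ p₂ * a).degree < n + a.degree := by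
      rw [h, degree_neg]
      exact (degree_add_le _ _).trans_lt (max_lt (hmul _ _ (natDegree_shiftedFst_le _ _ _ _) ha₁)
        (hmul _ _ (natDegree_shiftedSnd_le _ _ _ _) ha₂))
    rw [degree_mul, hq] at hlt
    exact lt_irrefl _ hlt
  have hp : paramPoly p₀ p₁ p₂ 0 = p₀ := by simp [paramPoly]
  have hp₀ : p₀ ≠ 0 := by rintro rfl; simp at h₁
  rcases degree_rePart_imPart_lt hp₀ with h | h
  · exact key _ _ _ (h _ h₁) (h _ h₂) (by simpa only [hp] using q₀_mul_rePart p₀ p₁ p₂ 0)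
  · exact key _ _ _ (h _ h₁) (h _ h₂) (by simpa only [hp] using q₀_mul_imPart p₀ p₁ p₂ 0)

/-- By coprimality the dominant part of `p` divides the same part of `q`, whose degree is smaller.
-/
theorem eq_zero_of_isCoprime_rePart_imPart {p q : ℝ[X]} (hp : p ≠ 0) (hq : q.degree < p.degree)
    (hcop : IsCoprime (rePart p) (imPart p))
    (h : imPart q * rePart p = rePart q * imPart p) : q = 0 := by
  have hzero : ∀ a b c d : ℝ[X], a.degree < b.degree → IsCoprime b c → d * b = a * c →
      a = 0 ∧ d = 0 := by
    intro a b c d hdeg hbc h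
    have hb : b ≠ 0 := by rintro rfl; simp at hdeg
    have ha : a = 0 := eq_zero_of_dvd_of_degree_lt
      (hbc.dvd_of_dvd_mul_right (Dvd.intro_left d h)) hdeg
    rw [ha, zero_mul] at h
    exact ⟨ha, (mul_eq_zero.1 h).resolve_right hb⟩
  have hRI : rePart q = 0 ∧ imPart q = 0 := by
    rcases degree_rePart_imPart_lt hp with hd | hd
    · exact hzero _ _ _ _ (hd q hq) hcop h
    · exact (hzero _ _ _ _ (hd q hq) hcop.symm h.symm).symm
  rw [eq_rePart_comp_add q, hRI.1, hRI.2]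
  simp

/-- If both coefficients vanished, then so would those of q₀, q₁, q₂ in their maximal degree; so all
three would be zero, and q₁ - k₁q₀ = 0 would force p₂ = 0. Coprimality at the single point `k` thus
settles every `k'`. -/
theorem coeff_shifted_ne_zero {p₀ p₁ p₂ : ℝ[X]} (h₁ : p₁.degree < p₀.degree)
    (h₂ : p₂.degree < p₀.degree) (hp₂ : p₂ ≠ 0) {k : ℝ × ℝ}
    (hk : IsCoprime (rePart (paramPoly p₀ p₁ p₂ k)) (imPart (paramPoly p₀ p₁ p₂ k)))
    (k' : ℝ × ℝ) :
    (shiftedFst p₀ p₁ p₂ k').coeff (pencilSize p₀ p₁ p₂) ≠ 0 ∨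
      (shiftedSnd p₀ p₁ p₂ k').coeff (pencilSize p₀ p₁ p₂) ≠ 0 := by
  have h0 := coeff_q₀_eq_zero h₁ h₂
  simp only [shiftedFst, shiftedSnd, coeff_sub, coeff_C_mul, h0, mul_zero, sub_zero]
  by_contra! hcon
  have hC : ∀ q : ℝ[X], q.coeff (pencilSize p₀ p₁ p₂) = 0 → q.natDegree ≤ pencilSize p₀ p₁ p₂ →
      pencilSize p₀ p₁ p₂ = 0 → q = 0 := by
    intro q hq hle hs
    rw [hs] at hq hle
    rw [eq_C_of_natDegree_le_zero hle, hq, C_0]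
  have hlead : ∀ q : ℝ[X], q.coeff (pencilSize p₀ p₁ p₂) = 0 →
      pencilSize p₀ p₁ p₂ = q.natDegree → pencilSize p₀ p₁ p₂ = 0 := by
    intro q hq hs
    rw [hs, coeff_natDegree, leadingCoeff_eq_zero] at hq
    rw [hs, hq, natDegree_zero]
  have hn : pencilSize p₀ p₁ p₂ = 0 := by
    have : pencilSize p₀ p₁ p₂ = (q₀ p₁ p₂).natDegree ∨
        pencilSize p₀ p₁ p₂ = (q₁ p₀ p₂).natDegree ∨
        pencilSize p₀ p₁ p₂ = (q₂ p₀ p₁).natDegree := by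
      unfold pencilSize
      omega
    rcases this with h | h | h
    · exact hlead _ h0 h
    · exact hlead _ hcon.1 h
    · exact hlead _ hcon.2 h
  have hq₀ := hC _ h0 (natDegree_q₀_le _ _ _) hn
  have hq₁ := hC _ hcon.1 (natDegree_q₁_le _ _ _) hn
  have hdeg := degree_paramPoly h₁ h₂ k
  have hne : paramPoly p₀ p₁ p₂ k ≠ 0 := by
    intro h
    rw [h, degree_zero] at hdeg
    rw [← hdeg] at h₁
    exact not_lt_bot h₁
  refine hp₂ (eq_zero_of_isCoprime_rePart_imPart hne (hdeg ▸ h₂) hk ?_)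
  rw [← sub_eq_zero, ← shiftedFst_eq, shiftedFst, hq₀, hq₁]
  simp

/-- If `q₁ - k₁ q₀` and `q₂ - k₂ q₀` are coprime at one parameter, they are coprime wherever `p_R`
and `p_I` are. -/
theorem isCoprime_shifted_of_isCoprime {p₀ p₁ p₂ : ℝ[X]} {k k' : ℝ × ℝ}
    (hG : IsCoprime (shiftedFst p₀ p₁ p₂ k) (shiftedSnd p₀ p₁ p₂ k))
    (hk' : IsCoprime (rePart (paramPoly p₀ p₁ p₂ k')) (imPart (paramPoly p₀ p₁ p₂ k'))) :
    IsCoprime (shiftedFst p₀ p₁ p₂ k') (shiftedSnd p₀ p₁ p₂ k') := by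
  refine isCoprime_of_forall_aeval fun l h1 h2 => ?_
  have hR := congrArg (aeval l) (q₀_mul_rePart p₀ p₁ p₂ k')
  have hI := congrArg (aeval l) (q₀_mul_imPart p₀ p₁ p₂ k')
  simp only [map_mul, map_neg, map_add, h1, h2, zero_mul, add_zero, neg_zero, mul_eq_zero] at hR hI
  -- A common root with q₀(l) = 0 is a root of q₁ and q₂ too, hence a common root at every
  -- parameter, in particular at `k`.
  by_cases h0 : aeval l (q₀ p₁ p₂) = 0
  · simp only [shiftedFst, shiftedSnd, map_sub, map_mul, h0, mul_zero, sub_zero] at h1 h2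
    refine aeval_ne_zero_of_isCoprime hG l ?_ ?_
    · simp [shiftedFst, h0, h1]
    · simp [shiftedSnd, h0, h2]
  · exact aeval_ne_zero_of_isCoprime hk' l (hR.resolve_left h0) (hI.resolve_left h0)

/-! ### Affine symmetric pencils in two parameters -/

section Pencil

variable {ι : Type*} {F₀ F₁ F₂ : Matrix ι ι ℝ}

theorem continuous_pencil : Continuous fun k : ℝ × ℝ => F₀ + k.1 • F₁ + k.2 • F₂ := by fun_prop

theorem isHermitian_pencil (h₀ : F₀.IsSymm) (h₁ : F₁.IsSymm) (h₂ : F₂.IsSymm) (k : ℝ × ℝ) :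
    (F₀ + k.1 • F₁ + k.2 • F₂).IsHermitian := by
  rw [Matrix.IsHermitian, Matrix.conjTranspose_eq_transpose_of_trivial]
  exact (h₀.add (h₁.smul _)).add (h₂.smul _)

theorem pencil_combination (x y : ℝ × ℝ) {a b : ℝ} (hab : a + b = 1) :
    F₀ + (a • x + b • y).1 • F₁ + (a • x + b • y).2 • F₂ =
      a • (F₀ + x.1 • F₁ + x.2 • F₂) + b • (F₀ + y.1 • F₁ + y.2 • F₂) := by
  ext i j
  simp only [Prod.fst_add, Prod.snd_add, Prod.smul_fst, Prod.smul_snd, Matrix.add_apply,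
    Matrix.smul_apply, smul_eq_mul]
  linear_combination -(F₀ i j) * hab

theorem convex_setOf_pencil_posDef : Convex ℝ {k : ℝ × ℝ | (F₀ + k.1 • F₁ + k.2 • F₂).PosDef} := by
  intro x hx y hy a b ha hb hab
  rw [Set.mem_ofPred_eq, pencil_combination x y hab]
  rcases ha.eq_or_lt with rfl | ha
  · rw [zero_add] at hab
    simpa [hab] using hy
  · exact (hx.smul ha).add_posSemidef (hy.posSemidef.smul hb)

variable [Fintype ι]

/-- Positivity on the compact unit sphere persists nearby, and homogeneity extends it to all nonzero
vectors. -/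
theorem isOpen_setOf_posDef {X : Type*} [TopologicalSpace X] {M : X → Matrix ι ι ℝ}
    (hM : Continuous M) (hsymm : ∀ x, (M x).IsHermitian) : IsOpen {x | (M x).PosDef} := by
  rw [isOpen_iff_mem_nhds]
  intro x₀ hx₀
  have hcont : Continuous fun z : X × (ι → ℝ) => z.2 ⬝ᵥ M z.1 *ᵥ z.2 :=
    continuous_snd.dotProduct ((hM.comp continuous_fst).matrix_mulVec continuous_snd)
  have h := (isCompact_sphere (0 : ι → ℝ) 1).eventually_forall_of_forall_eventually
    (x₀ := x₀) (P := fun x v => 0 < v ⬝ᵥ M x *ᵥ v) fun v hv =>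
      hcont.continuousAt.eventually (lt_mem_nhds (by
        refine hx₀.dotProduct_mulVec_pos (x := v) ?_
        rintro rfl
        simp at hv))
  filter_upwards [h] with x hx
  refine Matrix.PosDef.of_dotProduct_mulVec_pos (hsymm x) fun v hv => ?_
  have hn : 0 < ‖v‖ := norm_pos_iff.2 hv
  have h1 := hx (‖v‖⁻¹ • v) (by simp [norm_smul, hn.ne'])
  rw [Matrix.mulVec_smul, dotProduct_smul, smul_dotProduct, smul_eq_mul, smul_eq_mul] at h1
  have h2 := inv_pos.2 hn
  rw [mul_pos_iff_of_pos_left h2, mul_pos_iff_of_pos_left h2] at h1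
  exact h1

theorem isClosed_setOf_posSemidef {X : Type*} [TopologicalSpace X] {M : X → Matrix ι ι ℝ}
    (hM : Continuous M) (hsymm : ∀ x, (M x).IsHermitian) : IsClosed {x | (M x).PosSemidef} := by
  have : {x | (M x).PosSemidef} = ⋂ v : ι → ℝ, {x | 0 ≤ v ⬝ᵥ M x *ᵥ v} := by
    ext x
    simp only [Set.mem_ofPred_eq, Set.mem_iInter]
    exact ⟨fun h v => h.dotProduct_mulVec_nonneg v, fun h => .of_dotProduct_mulVec_nonneg (hsymm x) h⟩
  rw [this]
  exact isClosed_iInter fun v =>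
    isClosed_le continuous_const (continuous_const.dotProduct (hM.matrix_mulVec continuous_const))

/-- On the segment from a semidefinite point to the definite point `k`, every point past the start
is definite. -/
theorem closure_setOf_pencil_posDef (h₀ : F₀.IsSymm) (h₁ : F₁.IsSymm) (h₂ : F₂.IsSymm)
    {k : ℝ × ℝ} (hk : (F₀ + k.1 • F₁ + k.2 • F₂).PosDef) :
    closure {k : ℝ × ℝ | (F₀ + k.1 • F₁ + k.2 • F₂).PosDef} =
      {k : ℝ × ℝ | (F₀ + k.1 • F₁ + k.2 • F₂).PosSemidef} := by
  refine (closure_minimal (fun x hx => Matrix.PosDef.posSemidef hx)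
    (isClosed_setOf_posSemidef continuous_pencil (isHermitian_pencil h₀ h₁ h₂))).antisymm ?_
  intro x hx
  have hcont : Continuous fun t : ℝ => (1 - t) • x + t • k := by fun_prop
  have htend : Filter.Tendsto (fun t : ℝ => (1 - t) • x + t • k) (𝓝[>] 0) (𝓝 x) := by
    have := (hcont.tendsto 0).mono_left (nhdsWithin_le_nhds (s := Set.Ioi (0 : ℝ)))
    simpa using this
  refine mem_closure_of_tendsto htend ?_
  filter_upwards [Ioo_mem_nhdsGT (zero_lt_one (α := ℝ))] with t ht
  change (F₀ + ((1 - t) • x + t • k).1 • F₁ + ((1 - t) • x + t • k).2 • F₂).PosDef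
  rw [pencil_combination x k (by ring)]
  exact Matrix.PosDef.posSemidef_add (Matrix.PosSemidef.smul hx (by linarith [ht.2])) (hk.smul ht.1)

theorem isLMIRegion_setOf_pencil_posDef (h₀ : F₀.IsSymm) (h₁ : F₁.IsSymm) (h₂ : F₂.IsSymm) :
    IsLMIRegion {k : ℝ × ℝ | (F₀ + k.1 • F₁ + k.2 • F₂).PosDef} := by
  let e := (Fintype.equivFin ι).symm
  refine ⟨_, F₀.submatrix e e, F₁.submatrix e e, F₂.submatrix e e, h₀.submatrix e, h₁.submatrix e,
    h₂.submatrix e, Set.ext fun k =>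
    ⟨fun h => Matrix.PosDef.submatrix h e.injective, fun h => ?_⟩⟩
  have h' : ((F₀ + k.1 • F₁ + k.2 • F₂).submatrix e e).PosDef := h
  have := h'.submatrix e.symm.injective
  rwa [Matrix.submatrix_submatrix, e.self_comp_symm, Matrix.submatrix_id_id] at this

end Pencil

/-! ### Topology of the stability region -/

theorem aeval_paramPoly (p₀ p₁ p₂ : ℝ[X]) (k : ℝ × ℝ) (z : ℂ) :
    aeval z (paramPoly p₀ p₁ p₂ k) = aeval z p₀ + k.1 * aeval z p₁ + k.2 * aeval z p₂ := by
  simp [paramPoly]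

theorem continuous_aeval_paramPoly (p₀ p₁ p₂ : ℝ[X]) :
    Continuous fun x : (ℝ × ℝ) × ℂ => aeval x.2 (paramPoly p₀ p₁ p₂ x.1) := by
  simp only [aeval_paramPoly]
  have h : ∀ q : ℝ[X], Continuous fun x : (ℝ × ℝ) × ℂ => aeval x.2 q := fun q =>
    q.continuous_aeval.comp continuous_snd
  have := h p₀
  have := h p₁
  have := h p₂
  fun_prop

/-- Each factor satisfies |z - r| ≥ Re(z - r) ≥ Re z. The bound depends on `p` only through its
degree, so it survives limits of stable polynomials. -/
theorem IsStable.pow_le_norm_aeval {p : ℝ[X]} (hp : p.Monic) (hs : IsStable p) {z : ℂ}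
    (hz : 0 ≤ z.re) : z.re ^ p.natDegree ≤ ‖aeval z p‖ := by
  have hsplit := IsAlgClosed.splits (p.map (algebraMap ℝ ℂ))
  rw [← eval_map_algebraMap, hsplit.eval_eq_prod_roots_of_monic (hp.map _),
    ← natDegree_map (algebraMap ℝ ℂ), hsplit.natDegree_eq_card_roots]
  have hroots : ∀ r ∈ (p.map (algebraMap ℝ ℂ)).roots, r.re < 0 := by
    intro r hr
    refine hs r ?_
    rw [← eval_map_algebraMap]
    exact (mem_roots'.1 hr).2
  generalize (p.map (algebraMap ℝ ℂ)).roots = R at hroots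
  induction R using Multiset.induction with
  | empty => simp
  | cons r R ih =>
    rw [Multiset.map_cons, Multiset.prod_cons, Multiset.card_cons, pow_succ', norm_mul]
    have hr := hroots r (Multiset.mem_cons_self r R)
    refine mul_le_mul ?_ (ih fun s hs => hroots s (Multiset.mem_cons_of_mem hs)) (by positivity)
      (norm_nonneg _)
    calc z.re ≤ (z - r).re := by rw [Complex.sub_re]; linarith
      _ ≤ ‖z - r‖ := Complex.re_le_norm _

theorem re_le_zero_of_mem_closure_stabilityRegion {p₀ p₁ p₂ : ℝ[X]}
    (hmonic : ∀ k, (paramPoly p₀ p₁ p₂ k).Monic) {k : ℝ × ℝ}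
    (hk : k ∈ closure (stabilityRegion p₀ p₁ p₂)) {z : ℂ}
    (hz : aeval z (paramPoly p₀ p₁ p₂ k) = 0) : z.re ≤ 0 := by
  by_contra! hre
  have hcont : Continuous fun k => ‖aeval z (paramPoly p₀ p₁ p₂ k)‖ :=
    ((continuous_aeval_paramPoly p₀ p₁ p₂).comp (continuous_id.prodMk continuous_const)).norm
  have hsub : stabilityRegion p₀ p₁ p₂ ⊆
      {k | z.re ^ p₀.natDegree ≤ ‖aeval z (paramPoly p₀ p₁ p₂ k)‖} := by
    intro k hk
    have h := IsStable.pow_le_norm_aeval (hmonic k) hk hre.le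
    rwa [natDegree_eq_of_degree_eq
      (degree_paramPoly (degree_fst_lt hmonic) (degree_snd_lt hmonic) k)] at h
  have h := closure_minimal hsub (isClosed_le continuous_const hcont) hk
  rw [Set.mem_ofPred_eq, hz, norm_zero] at h
  exact (pow_pos hre _).not_ge h

/-- A sum replaces the maximum in Cauchy's bound, to be visibly continuous in the coefficients. -/
theorem norm_le_of_aeval_eq_zero {p : ℝ[X]} (hp : p.Monic) {z : ℂ} (hz : aeval z p = 0) :
    ‖z‖ ≤ ∑ i ∈ Finset.range p.natDegree, |p.coeff i| + 1 := by
  have hp' := hp.map (algebraMap ℝ ℂ)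
  have h := IsRoot.norm_lt_cauchyBound (a := z) hp'.ne_zero
    (by rw [IsRoot.def, eval_map_algebraMap, hz])
  rw [cauchyBound, hp'.leadingCoeff, nnnorm_one, div_one, natDegree_map] at h
  have h' : (‖z‖₊ : ℝ) < ((Finset.range p.natDegree).sup
    (fun i => ‖(p.map (algebraMap ℝ ℂ)).coeff i‖₊) + 1 : NNReal) := by exact_mod_cast h
  refine h'.le.trans ?_
  rw [NNReal.coe_add, NNReal.coe_one]
  gcongr
  have hsup : (Finset.range p.natDegree).sup (fun i => ‖(p.map (algebraMap ℝ ℂ)).coeff i‖₊) ≤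
      ∑ i ∈ Finset.range p.natDegree, ‖(p.map (algebraMap ℝ ℂ)).coeff i‖₊ :=
    Finset.sup_le fun i hi => Finset.single_le_sum
      (f := fun i => ‖(p.map (algebraMap ℝ ℂ)).coeff i‖₊) (fun _ _ => zero_le) hi
  refine (NNReal.coe_le_coe.2 hsup).trans_eq ?_
  rw [NNReal.coe_sum]
  refine Finset.sum_congr rfl fun i _ => ?_
  simp

theorem isOpen_stabilityRegion {p₀ p₁ p₂ : ℝ[X]}
    (hmonic : ∀ k, (paramPoly p₀ p₁ p₂ k).Monic) : IsOpen (stabilityRegion p₀ p₁ p₂) := by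
  rw [isOpen_iff_mem_nhds]
  intro k₀ hk₀
  set M : ℝ × ℝ → ℝ := fun k =>
    ∑ i ∈ Finset.range p₀.natDegree, |(paramPoly p₀ p₁ p₂ k).coeff i| with hM
  have hMcont : Continuous M := by
    simp only [hM, paramPoly, coeff_add, coeff_C_mul]
    fun_prop
  have hroot : ∀ (k : ℝ × ℝ) (z : ℂ), aeval z (paramPoly p₀ p₁ p₂ k) = 0 → ‖z‖ ≤ M k + 1 := by
    intro k z hz
    have h := norm_le_of_aeval_eq_zero (hmonic k) hz
    rwa [natDegree_eq_of_degree_eq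
      (degree_paramPoly (degree_fst_lt hmonic) (degree_snd_lt hmonic) k)] at h
  -- For k near k₀ every root with Re z ≥ 0 lies in this compact half-disc, because M k < M k₀ + 1.
  have hK : IsCompact (Metric.closedBall (0 : ℂ) (M k₀ + 2) ∩ {z | 0 ≤ z.re}) :=
    (isCompact_closedBall _ _).inter_right (isClosed_le continuous_const Complex.continuous_re)
  have h1 := hK.eventually_forall_of_forall_eventually (x₀ := k₀)
    (P := fun k z => aeval z (paramPoly p₀ p₁ p₂ k) ≠ 0) fun z hz =>
      (continuous_aeval_paramPoly p₀ p₁ p₂).continuousAt.eventually_ne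
        fun h0 => (hk₀ z h0).not_ge hz.2
  have h2 := hMcont.continuousAt.eventually (gt_mem_nhds (lt_add_one (M k₀)))
  filter_upwards [h1, h2] with k hk1 hk2 z hz
  by_contra! hre
  refine hk1 z ⟨?_, hre⟩ hz
  rw [mem_closedBall_zero_iff]
  linarith [hroot k z hz]

/-! ### The pencil C(k) and the curve -/

theorem exists_pencilC_eq (p₀ p₁ p₂ : ℝ[X]) :
    ∃ F₀ F₁ F₂ : Matrix (Fin 1 ⊕ Fin (pencilSize p₀ p₁ p₂)) (Fin 1 ⊕ Fin (pencilSize p₀ p₁ p₂)) ℝ,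
      F₀.IsSymm ∧ F₁.IsSymm ∧ F₂.IsSymm ∧
        pencilC p₀ p₁ p₂ = fun k => F₀ + k.1 • F₁ + k.2 • F₂ := by
  have hsymm : ∀ (c : ℝ) (a b : ℝ[X]), (Matrix.fromBlocks (Matrix.of fun _ _ => c : Matrix (Fin 1)
      (Fin 1) ℝ) 0 0 (bezoutian (pencilSize p₀ p₁ p₂) a b)).IsSymm := fun c a b =>
    Matrix.IsSymm.fromBlocks rfl (Matrix.transpose_zero) (bezoutian_isSymm _ _ _)
  refine ⟨_, _, _, hsymm ((rePart p₀).eval 0) (q₁ p₀ p₂) (q₂ p₀ p₁),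
    hsymm ((rePart p₁).eval 0) (q₂ p₀ p₁) (q₀ p₁ p₂),
    hsymm ((rePart p₂).eval 0) (q₀ p₁ p₂) (q₁ p₀ p₂), ?_⟩
  funext k
  rw [pencilC, pencilG, Matrix.fromBlocks_smul, Matrix.fromBlocks_smul, Matrix.fromBlocks_add,
    Matrix.fromBlocks_add]
  congr 1
  all_goals simp

variable {p₀ p₁ p₂ : ℝ[X]}

theorem lineForm_pos_of_posDef {k : ℝ × ℝ} (h : (pencilC p₀ p₁ p₂ k).PosDef) :
    0 < lineForm p₀ p₁ p₂ k := by
  simpa [pencilC] using h.diag_pos (i := Sum.inl 0)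

theorem det_pencilC (p₀ p₁ p₂ : ℝ[X]) (k : ℝ × ℝ) :
    (pencilC p₀ p₁ p₂ k).det = lineForm p₀ p₁ p₂ k * (pencilG p₀ p₁ p₂ k).det := by
  rw [pencilC, Matrix.det_fromBlocks_zero₂₁, Matrix.det_unique]
  rfl

theorem lineForm_eq_eval (p₀ p₁ p₂ : ℝ[X]) (k : ℝ × ℝ) :
    lineForm p₀ p₁ p₂ k = (rePart (paramPoly p₀ p₁ p₂ k)).eval 0 := by
  simp [rePart_paramPoly, lineForm]

/-- The imaginary part carries a factor ω, so at ω = 0 the only condition is p_R(0,k) = 0. This is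
why l(k) stands beside G(k) in the pencil. -/
theorem mem_curve_of_lineForm_eq_zero {k : ℝ × ℝ} (h : lineForm p₀ p₁ p₂ k = 0) :
    k ∈ curve p₀ p₁ p₂ := by
  refine ⟨0, ?_⟩
  rw [aeval_I_mul]
  rw [lineForm_eq_eval] at h
  simp [h]

/-- On the curve and off the line `l(k) = 0`, the polynomials `q₁ - k₁ q₀` and `q₂ - k₂ q₀` have a
common root. -/
theorem not_isCoprime_of_mem_curve {k : ℝ × ℝ} (h : k ∈ curve p₀ p₁ p₂)
    (hl : lineForm p₀ p₁ p₂ k ≠ 0) :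
    ¬ IsCoprime (shiftedFst p₀ p₁ p₂ k) (shiftedSnd p₀ p₁ p₂ k) := by
  obtain ⟨ω, hω⟩ := h
  rw [aeval_I_mul, mul_comm Complex.I] at hω
  have hR : (rePart (paramPoly p₀ p₁ p₂ k)).eval (ω ^ 2) = 0 := by
    simpa using congrArg Complex.re hω
  have hI : ω * (imPart (paramPoly p₀ p₁ p₂ k)).eval (ω ^ 2) = 0 := by
    simpa using congrArg Complex.im hω
  have hI' : (imPart (paramPoly p₀ p₁ p₂ k)).eval (ω ^ 2) = 0 := by
    refine (mul_eq_zero.1 hI).resolve_left ?_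
    rintro rfl
    rw [lineForm_eq_eval] at hl
    exact hl (by simpa using hR)
  rintro ⟨a, b, hab⟩
  have := congrArg (eval (ω ^ 2)) hab
  rw [shiftedFst_eq, shiftedSnd_eq] at this
  simp [hR, hI'] at this

/-- A common root gives roots s and -s; on the closure both have real part at most 0, so s is
imaginary. -/
theorem mem_curve_of_not_isCoprime (hmonic : ∀ k, (paramPoly p₀ p₁ p₂ k).Monic) {k : ℝ × ℝ}
    (hk : k ∈ closure (stabilityRegion p₀ p₁ p₂))
    (h : ¬ IsCoprime (rePart (paramPoly p₀ p₁ p₂ k)) (imPart (paramPoly p₀ p₁ p₂ k))) :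
    k ∈ curve p₀ p₁ p₂ := by
  by_contra hcurve
  refine h (isCoprime_of_forall_aeval fun l hR hI => ?_)
  obtain ⟨s, -, h1, h2⟩ := exists_opposite_roots hR hI
  have hre1 := re_le_zero_of_mem_closure_stabilityRegion hmonic hk h1
  have hre2 := re_le_zero_of_mem_closure_stabilityRegion hmonic hk h2
  rw [Complex.neg_re] at hre2
  refine hcurve ⟨s.im, ?_⟩
  rwa [show Complex.I * (s.im : ℂ) = s by
    apply Complex.ext <;> simp
    linarith]

theorem isStable_of_hermiteMatrix_posDef {k : ℝ × ℝ} (hd : (paramPoly p₀ p₁ p₂ k).natDegree ≠ 0)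
    (hH : (hermiteMatrix (paramPoly p₀ p₁ p₂ k)).PosDef) (hk : k ∉ curve p₀ p₁ p₂) :
    k ∈ stabilityRegion p₀ p₁ p₂ := by
  intro z hz
  refine lt_of_le_of_ne (re_le_zero_of_hermiteMatrix_posDef hd hH hz) fun h0 => hk ⟨z.im, ?_⟩
  rwa [show Complex.I * (z.im : ℂ) = z by apply Complex.ext <;> simp [h0]]

/-- The pencil region containing a stable parameter is stable, avoids the curve, and is bounded by
it. -/
theorem pencil_region_properties (hmonic : ∀ k, (paramPoly p₀ p₁ p₂ k).Monic) (hp₂ : p₂ ≠ 0)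
    {k : ℝ × ℝ} (hk : k ∈ stabilityRegion p₀ p₁ p₂) (hC : (pencilC p₀ p₁ p₂ k).PosDef) :
    {k' | (pencilC p₀ p₁ p₂ k').PosDef} ⊆ (curve p₀ p₁ p₂)ᶜ ∧
      {k' | (pencilC p₀ p₁ p₂ k').PosDef} ⊆ stabilityRegion p₀ p₁ p₂ ∧
      closure {k' | (pencilC p₀ p₁ p₂ k').PosDef} ∩ (curve p₀ p₁ p₂)ᶜ ⊆
        {k' | (pencilC p₀ p₁ p₂ k').PosDef} := by
  have hdet : ∀ k', (pencilG p₀ p₁ p₂ k').det ≠ 0 ↔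
      IsCoprime (shiftedFst p₀ p₁ p₂ k') (shiftedSnd p₀ p₁ p₂ k') := fun k' => by
    rw [pencilG_eq_bezoutian]
    exact det_bezoutian_ne_zero_iff (natDegree_shiftedFst_le _ _ _ _)
      (natDegree_shiftedSnd_le _ _ _ _) (coeff_shifted_ne_zero (degree_fst_lt hmonic)
        (degree_snd_lt hmonic) hp₂ (IsStable.isCoprime_rePart_imPart hk) k')
  have hG : ∀ k', (pencilC p₀ p₁ p₂ k').PosDef →
      IsCoprime (shiftedFst p₀ p₁ p₂ k') (shiftedSnd p₀ p₁ p₂ k') := fun k' h => by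
    have := h.det_pos.ne'
    rw [det_pencilC] at this
    exact (hdet k').1 (right_ne_zero_of_mul this)
  have hsub : {k' | (pencilC p₀ p₁ p₂ k').PosDef} ⊆ (curve p₀ p₁ p₂)ᶜ := fun k' h hcurve =>
    not_isCoprime_of_mem_curve hcurve (lineForm_pos_of_posDef h).ne' (hG k' h)
  obtain ⟨F₀, F₁, F₂, h₀, h₁, h₂, hF⟩ := exists_pencilC_eq p₀ p₁ p₂
  have hconn : IsPreconnected {k' | (pencilC p₀ p₁ p₂ k').PosDef} := by
    rw [hF]
    exact convex_setOf_pencil_posDef.isPreconnected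
  have hstable : {k' | (pencilC p₀ p₁ p₂ k').PosDef} ⊆ stabilityRegion p₀ p₁ p₂ := by
    -- Stability is also closed within the pencil region: a limit could only acquire imaginary
    -- roots, and the curve is avoided there.
    refine hconn.subset_of_closure_inter_subset (isOpen_stabilityRegion hmonic) ⟨k, hC, hk⟩ ?_
    rintro k' ⟨hk', hC'⟩ z hz
    refine lt_of_le_of_ne (re_le_zero_of_mem_closure_stabilityRegion hmonic hk' hz) fun h0 =>
      hsub hC' ⟨z.im, ?_⟩
    rwa [show Complex.I * (z.im : ℂ) = z by apply Complex.ext <;> simp [h0]]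
  refine ⟨hsub, hstable, ?_⟩
  rintro k' ⟨hk', hcurve⟩
  have hsemi : (pencilC p₀ p₁ p₂ k').PosSemidef := by
    rw [hF] at hk' hC ⊢
    have := closure_setOf_pencil_posDef h₀ h₁ h₂ hC
    exact (this.subset hk' :)
  refine hsemi.posDef_iff_det_ne_zero.2 ?_
  rw [det_pencilC]
  refine mul_ne_zero (fun h => hcurve (mem_curve_of_lineForm_eq_zero h)) ((hdet k').2 ?_)
  refine isCoprime_shifted_of_isCoprime (hG k hC) ?_
  by_contra h
  exact hcurve (mem_curve_of_not_isCoprime hmonic (closure_mono hstable hk') h)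

end TwoParam

/-! ### Identification of the component with the pencil region -/

theorem mainTheorem1 (p₀ p₁ p₂ : Polynomial ℝ)
    (hmonic : ∀ k : ℝ × ℝ, (TwoParam.paramPoly p₀ p₁ p₂ k).Monic)
    (hp₂ : p₂ ≠ 0) (hratio : ∀ c : ℝ, p₁ ≠ Polynomial.C c * p₂)
    (Si : Set (ℝ × ℝ))
    (hSi : ∃ x ∈ (TwoParam.curve p₀ p₁ p₂)ᶜ,
      Si = connectedComponentIn (TwoParam.curve p₀ p₁ p₂)ᶜ x)
    (k : ℝ × ℝ) (hk : k ∈ interior Si)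
    (hH : (TwoParam.hermiteMatrix (TwoParam.paramPoly p₀ p₁ p₂ k)).PosDef)
    (hC : (TwoParam.pencilC p₀ p₁ p₂ k).PosDef) :
    TwoParam.IsLMIRegion Si ∧
      Si = {k' | (TwoParam.pencilC p₀ p₁ p₂ k').PosDef} ∧
      closure Si = {k' | (TwoParam.pencilC p₀ p₁ p₂ k').PosSemidef} ∧
      Si ⊆ TwoParam.stabilityRegion p₀ p₁ p₂ := by
  obtain ⟨x, -, rfl⟩ := hSi
  have hkx := interior_subset hk
  have hkcurve : k ∈ (TwoParam.curve p₀ p₁ p₂)ᶜ := connectedComponentIn_subset _ _ hkx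
  have hdeg : (TwoParam.paramPoly p₀ p₁ p₂ k).natDegree ≠ 0 := by
    rw [Polynomial.natDegree_eq_of_degree_eq (TwoParam.degree_paramPoly
      (TwoParam.degree_fst_lt hmonic) (TwoParam.degree_snd_lt hmonic) k)]
    exact (Polynomial.natDegree_lt_natDegree hp₂ (TwoParam.degree_snd_lt hmonic)).ne_bot
  have hstable := TwoParam.isStable_of_hermiteMatrix_posDef hdeg hH hkcurve
  obtain ⟨hsub, hst, hcl⟩ := TwoParam.pencil_region_properties hmonic hp₂ hstable hC
  obtain ⟨F₀, F₁, F₂, h₀, h₁, h₂, hF⟩ := TwoParam.exists_pencilC_eq p₀ p₁ p₂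
  have hopen : IsOpen {k' | (TwoParam.pencilC p₀ p₁ p₂ k').PosDef} := by
    rw [hF]
    exact TwoParam.isOpen_setOf_posDef TwoParam.continuous_pencil
      (TwoParam.isHermitian_pencil h₀ h₁ h₂)
  have hconn : IsPreconnected {k' | (TwoParam.pencilC p₀ p₁ p₂ k').PosDef} := by
    rw [hF]
    exact TwoParam.convex_setOf_pencil_posDef.isPreconnected
  have heq : connectedComponentIn (TwoParam.curve p₀ p₁ p₂)ᶜ x =
      {k' | (TwoParam.pencilC p₀ p₁ p₂ k').PosDef} := by
    refine Set.Subset.antisymm ?_ ?_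
    -- The pencil region is open and closed relative to the component and contains `k`.
    · exact isPreconnected_connectedComponentIn.subset_of_closure_inter_subset hopen ⟨k, hkx, hC⟩
        fun k' h => hcl ⟨h.1, connectedComponentIn_subset _ _ h.2⟩
    · rw [connectedComponentIn_eq hkx]
      exact hconn.subset_connectedComponentIn hC hsub
  rw [heq]
  refine ⟨?_, rfl, ?_, hst⟩
  · rw [hF]
    exact TwoParam.isLMIRegion_setOf_pencil_posDef h₀ h₁ h₂
  · rw [hF] at hC ⊢
    exact TwoParam.closure_setOf_pencil_posDef h₀ h₁ h₂ hC
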